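/- Let $G$ be a finite group and let $T$ be a $G$-Tambara functor. A Tambara ideal $I$ of $T$ is a collection of ideals $I(G/H) \subseteq T(G/H)$, one for each subgroup $H \le G$, that is closed under the restriction, transfer, norm and conjugation maps of $T$. The product $IJ$ of two Tambara ideals is the smallest Tambara ideal containing the ideals $I(G/H)\cdot J(G/H)$ for all $H \le G$, and $I^N$ denotes the $N$-fold product of $I$ with itself. For $i = 1, \dots, n$ let $H_i \le G$ be a subgroup and let $x_i \in T(G/H_i)$. Let $I = \langle x_1, \dots, x_n \rangle$ be the Tambara ideal generated by the $x_i$, i.e. the smallest Tambara ideal of $T$ with $x_i \in I(G/H_i)$ for all $i$. If each $x_i$ is nilpotent in the commutative ring $T(G/H_i)$, then $I$ is nilpotent: there is an integer $N \ge 1$ such that $I^N = 0$, i.e. $I^N(G/K) = 0$ for every subgroup $K \le G$. -/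

import Mathlib

universe u v

/-- A finite `G`-set. Morphisms are the equivariant maps `X →[G] Y`. -/
structure FinGSet (G : Type u) [Group G] where
  carrier : Type u
  [action : MulAction G carrier]
  [finite : Finite carrier]

namespace FinGSet

variable {G : Type u} [Group G]

instance : CoeSort (FinGSet G) (Type u) := ⟨FinGSet.carrier⟩

instance (X : FinGSet G) : MulAction G X := X.action

instance (X : FinGSet G) : Finite X := X.finite

/-- The disjoint union `X ⨿ Y`. -/
def sum (X Y : FinGSet G) : FinGSet G where
  carrier := X ⊕ Y

/-- The inclusion `X → X ⨿ Y`. -/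
def inl (X Y : FinGSet G) : X →[G] X.sum Y where
  toFun := Sum.inl
  map_smul' _ _ := rfl

/-- The inclusion `Y → X ⨿ Y`. -/
def inr (X Y : FinGSet G) : Y →[G] X.sum Y where
  toFun := Sum.inr
  map_smul' _ _ := rfl

/-- The fold map `∇ : X ⨿ X → X`. -/
def fold (X : FinGSet G) : X.sum X →[G] X where
  toFun := Sum.elim id id
  map_smul' g z := by cases z <;> rfl

/-- The square
```
  P --g'--> X
  |         |
  f'        f
  v         v
  X' --g--> Y
```
is a pullback square of finite `G`-sets: it commutes, and `P` maps bijectively onto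
`{(x, x') | f x = g x'}`. -/
def IsPullbackSquare {P X X' Y : FinGSet G}
    (g' : P →[G] X) (f' : P →[G] X') (f : X →[G] Y) (g : X' →[G] Y) : Prop :=
  (∀ a : P, f (g' a) = g (f' a)) ∧
    ∀ (x : X) (x' : X'), f x = g x' → ∃! a : P, g' a = x ∧ f' a = x'

/-- The diagram
```
     A ---f'--> B
   ε/ \         |
   /   \ g∘ε    | p
  v     v       v
  X -g-> Y -f-> Z
```
is an exponential diagram of finite `G`-sets: the right-hand square is a pullback, and `p` is the
dependent product `Π_f g` with counit `ε`. That is, the points of `B` over `z : Z` correspond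
bijectively to the sections `s` of `g` over the fibre `f⁻¹(z)`, where the section that corresponds
to `b` takes at `y` the value `ε a`, for `a` the point of the pullback `A` over `(y, b)`. -/
def IsExponential {X Y Z A B : FinGSet G}
    (g : X →[G] Y) (f : Y →[G] Z) (ε : A →[G] X) (f' : A →[G] B) (p : B →[G] Z) : Prop :=
  IsPullbackSquare (g.comp ε) f' f p ∧
    ∀ (z : Z) (s : {y : Y // f y = z} → X), (∀ y, g (s y) = y.1) →
      ∃! b : B, p b = z ∧
        ∀ (a : A) (y : {y : Y // f y = z}), f' a = b → g (ε a) = y.1 → ε a = s y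

variable [Finite G]

/-- The orbit `G/H`. -/
def orbit (H : Subgroup G) : FinGSet G where
  carrier := G ⧸ H

/-- The canonical quotient map `G/H → G/K`, `xH ↦ xK`, for `H ≤ K`. -/
def proj {H K : Subgroup G} (h : H ≤ K) : orbit H →[G] orbit K where
  toFun := Subgroup.quotientMapOfLE h
  map_smul' g x := by
    induction x using QuotientGroup.induction_on with
    | H x => rfl

/-- The conjugate subgroup `gHg⁻¹`. -/
def conjSubgroup (g : G) (H : Subgroup G) : Subgroup G :=
  H.map (MulAut.conj g).toMonoidHom

/-- The canonical isomorphism `G/H → G/gHg⁻¹`, `xH ↦ xg⁻¹(gHg⁻¹)`. -/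
def conjMap (g : G) (H : Subgroup G) : orbit H →[G] orbit (conjSubgroup g H) where
  toFun := Quotient.map' (fun x => x * g⁻¹) fun x y hxy => by
    rw [QuotientGroup.leftRel_apply] at hxy ⊢
    exact ⟨x⁻¹ * y, hxy, by simp [mul_assoc]⟩
  map_smul' a x := by
    induction x using QuotientGroup.induction_on with
    | H x => exact congrArg QuotientGroup.mk (mul_assoc a x g⁻¹)

end FinGSet

/-- A `G`-Tambara functor: a product-preserving functor, from the category of bispans of finite
`G`-sets to sets, all of whose values are commutative rings. It is given by its values on finite
`G`-sets and by transfers `tr f`, norms `nm f` and restrictions `res f` (the images of the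
bispans `T_f`, `N_f`, `R_f`), subject to the rules for composing bispans. -/
structure TambaraFunctor (G : Type u) [Group G] where
  obj : FinGSet G → Type v
  [commRing : ∀ X, CommRing (obj X)]
  tr : ∀ {X Y : FinGSet G}, (X →[G] Y) → obj X → obj Y
  nm : ∀ {X Y : FinGSet G}, (X →[G] Y) → obj X → obj Y
  res : ∀ {X Y : FinGSet G}, (X →[G] Y) → obj Y → obj X
  -- functoriality
  tr_id : ∀ {X : FinGSet G} (a : obj X), tr (MulActionHom.id G) a = a
  nm_id : ∀ {X : FinGSet G} (a : obj X), nm (MulActionHom.id G) a = a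
  res_id : ∀ {X : FinGSet G} (a : obj X), res (MulActionHom.id G) a = a
  tr_comp : ∀ {X Y Z : FinGSet G} (f : Y →[G] Z) (g : X →[G] Y) (a : obj X),
    tr (f.comp g) a = tr f (tr g a)
  nm_comp : ∀ {X Y Z : FinGSet G} (f : Y →[G] Z) (g : X →[G] Y) (a : obj X),
    nm (f.comp g) a = nm f (nm g a)
  res_comp : ∀ {X Y Z : FinGSet G} (f : Y →[G] Z) (g : X →[G] Y) (a : obj Z),
    res (f.comp g) a = res g (res f a)
  -- base change
  res_tr : ∀ {P X X' Y : FinGSet G} {g' : P →[G] X} {f' : P →[G] X'} {f : X →[G] Y}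
    {g : X' →[G] Y}, FinGSet.IsPullbackSquare g' f' f g →
    ∀ a : obj X', res f (tr g a) = tr g' (res f' a)
  res_nm : ∀ {P X X' Y : FinGSet G} {g' : P →[G] X} {f' : P →[G] X'} {f : X →[G] Y}
    {g : X' →[G] Y}, FinGSet.IsPullbackSquare g' f' f g →
    ∀ a : obj X', res f (nm g a) = nm g' (res f' a)
  -- distributivity of norms over transfers
  nm_tr : ∀ {X Y Z A B : FinGSet G} {g : X →[G] Y} {f : Y →[G] Z} {ε : A →[G] X}
    {f' : A →[G] B} {p : B →[G] Z}, FinGSet.IsExponential g f ε f' p →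
    ∀ a : obj X, nm f (tr g a) = tr p (nm f' (res ε a))
  -- preservation of finite products
  subsingleton_of_isEmpty : ∀ X : FinGSet G, IsEmpty X → Subsingleton (obj X)
  bijective_res_sum : ∀ X Y : FinGSet G, Function.Bijective
    fun a : obj (X.sum Y) => (res (FinGSet.inl X Y) a, res (FinGSet.inr X Y) a)
  -- the ring structure is the one induced by the fold maps
  tr_fold : ∀ {X : FinGSet G} (a : obj (X.sum X)),
    tr X.fold a = res (FinGSet.inl X X) a + res (FinGSet.inr X X) a
  nm_fold : ∀ {X : FinGSet G} (a : obj (X.sum X)),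
    nm X.fold a = res (FinGSet.inl X X) a * res (FinGSet.inr X X) a

attribute [instance] TambaraFunctor.commRing

namespace TambaraFunctor

variable {G : Type u} [Group G] [Finite G] (T : TambaraFunctor.{u, v} G)

/-- The commutative ring `T(G/H)`. -/
abbrev level (H : Subgroup G) : Type v := T.obj (FinGSet.orbit H)

/-- The conjugation `c_{g,H} : T(G/H) → T(G/gHg⁻¹)`. -/
def conj (g : G) (H : Subgroup G) : T.level H → T.level (FinGSet.conjSubgroup g H) :=
  T.tr (FinGSet.conjMap g H)

/-- A Tambara ideal of `T`: ideals `I(G/H) ⊆ T(G/H)` for all `H ≤ G`, closed under restrictions,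
transfers, norms and conjugations. -/
structure TambaraIdeal where
  level : ∀ H : Subgroup G, Ideal (T.level H)
  res_mem : ∀ {H K : Subgroup G} (h : H ≤ K) {a : T.level K},
    a ∈ level K → T.res (FinGSet.proj h) a ∈ level H
  tr_mem : ∀ {H K : Subgroup G} (h : H ≤ K) {a : T.level H},
    a ∈ level H → T.tr (FinGSet.proj h) a ∈ level K
  nm_mem : ∀ {H K : Subgroup G} (h : H ≤ K) {a : T.level H},
    a ∈ level H → T.nm (FinGSet.proj h) a ∈ level K
  conj_mem : ∀ (g : G) {H : Subgroup G} {a : T.level H},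
    a ∈ level H → T.conj g H a ∈ level (FinGSet.conjSubgroup g H)

namespace TambaraIdeal

variable {T}

/-- The unit ideal, `T` itself. -/
def top : TambaraIdeal T where
  level _ := ⊤
  res_mem _ _ _ := Submodule.mem_top
  tr_mem _ _ _ := Submodule.mem_top
  nm_mem _ _ _ := Submodule.mem_top
  conj_mem _ _ _ _ := Submodule.mem_top

/-- The levelwise intersection of a set of Tambara ideals. -/
def inter (S : Set (TambaraIdeal T)) : TambaraIdeal T where
  level H := ⨅ I ∈ S, I.level H
  res_mem h _ ha := by
    simp only [Submodule.mem_iInf] at ha ⊢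
    exact fun I hI => I.res_mem h (ha I hI)
  tr_mem h _ ha := by
    simp only [Submodule.mem_iInf] at ha ⊢
    exact fun I hI => I.tr_mem h (ha I hI)
  nm_mem h _ ha := by
    simp only [Submodule.mem_iInf] at ha ⊢
    exact fun I hI => I.nm_mem h (ha I hI)
  conj_mem g _ _ ha := by
    simp only [Submodule.mem_iInf] at ha ⊢
    exact fun I hI => I.conj_mem g (ha I hI)

/-- The ideal `⟨x_i : i ∈ ι⟩` generated by elements `x_i ∈ T(G/H_i)`: the smallest Tambara ideal
that contains all of them. -/
def span {ι : Type*} (H : ι → Subgroup G) (x : ∀ i, T.level (H i)) : TambaraIdeal T :=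
  inter {J | ∀ i, x i ∈ J.level (H i)}

/-- The product `IJ`: the smallest Tambara ideal that contains the ideals `I(G/H) · J(G/H)` for
all `H ≤ G`. -/
instance : Mul (TambaraIdeal T) :=
  ⟨fun I J => inter {K | ∀ H : Subgroup G, I.level H * J.level H ≤ K.level H}⟩

/-- The powers `I⁰ = T`, `Iⁿ⁺¹ = Iⁿ I`. -/
def pow (I : TambaraIdeal T) : ℕ → TambaraIdeal T
  | 0 => top
  | n + 1 => pow I n * I

instance : Pow (TambaraIdeal T) ℕ := ⟨pow⟩

end TambaraIdeal

end TambaraFunctor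

/-! By additivity the `x i` assemble into one nilpotent element `x` over the disjoint union `X` of
the orbits (`exists_nilpotent_of_fin`). Call `nm v (res w x)` a norm product of weight `m` if every
fibre of `v` has at least `m` points. The elements `tr u (c * p)`, with `p` a norm product of weight
`m`, form a Tambara ideal `transferIdeal x m`: closure under norms is the distributive law, closure
under products is Frobenius reciprocity and base change. Weights add under multiplication, so the
`N`-th power of the span lies in `transferIdeal x N`.

It remains to see that norm products of large weight vanish (`exists_nm_eq_zero`). Vanishing can be
tested over orbits. In a large fibre, many points share their stabilizer and their image in `X`.
They spread over many orbits of the source, each of which contributes the same factor `nm v₀ (res w₀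
x)` (`pow_dvd_nm`), and a high power of this factor is the norm of the restriction of a vanishing
power of `x`. -/

namespace FinGSet

/-! ### Finite `G`-sets: pullbacks and exponential diagrams. -/

variable {G : Type u} [Group G] {X Y Z W : FinGSet G}

/-- The map `X ⨿ Y → Z` with components `f` and `g`. -/
def desc (f : X →[G] Z) (g : Y →[G] Z) : X.sum Y →[G] Z where
  toFun := Sum.elim f g
  map_smul' a z := by cases z <;> exact map_smul _ _ _

/-- The coproduct `X ⨿ Y → Z ⨿ W` of two maps. -/
def sumMap (f : X →[G] Z) (g : Y →[G] W) : X.sum Y →[G] Z.sum W where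
  toFun := Sum.map f g
  map_smul' a z := by
    cases z
    · exact congrArg Sum.inl (map_smul f _ _)
    · exact congrArg Sum.inr (map_smul g _ _)

/-- The empty `G`-set. -/
def empty (G : Type u) [Group G] : FinGSet G where
  carrier := PEmpty
  action := { smul := fun _ x => x, one_smul := fun x => x.elim, mul_smul := fun _ _ x => x.elim }

instance : IsEmpty (empty G) := inferInstanceAs (IsEmpty PEmpty)

/-- The map from an empty `G`-set. -/
def ofIsEmpty [IsEmpty X] : X →[G] Y where
  toFun := isEmptyElim
  map_smul' _ x := isEmptyElim x

/-- The invariant subset of `X` cut out by `p`. -/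
def subset (p : X → Prop) (hp : ∀ (a : G) x, p x → p (a • x)) : FinGSet G where
  carrier := {x : X // p x}
  action :=
    { smul := fun a x => ⟨a • x.1, hp a x.1 x.2⟩
      one_smul := fun x => Subtype.ext (one_smul G x.1)
      mul_smul := fun a b x => Subtype.ext (mul_smul a b x.1) }

/-- The inclusion of an invariant subset. -/
def subsetVal (p : X → Prop) (hp : ∀ (a : G) x, p x → p (a • x)) : subset p hp →[G] X where
  toFun x := x.1
  map_smul' _ _ := rfl

/-- The product `X × Y`. -/
def prod (X Y : FinGSet G) : FinGSet G where
  carrier := X × Y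

/-- The fibre product of `f` and `g`. -/
def fibreProd (f : X →[G] Z) (g : Y →[G] Z) : FinGSet G :=
  subset (X := X.prod Y) (fun q => f q.1 = g q.2) fun a q h =>
    (map_smul f a q.1).trans ((congrArg (a • ·) h).trans (map_smul g a q.2).symm)

/-- The first projection of the fibre product. -/
def fibreFst (f : X →[G] Z) (g : Y →[G] Z) : fibreProd f g →[G] X where
  toFun q := q.1.1
  map_smul' _ _ := rfl

/-- The second projection of the fibre product. -/
def fibreSnd (f : X →[G] Z) (g : Y →[G] Z) : fibreProd f g →[G] Y where
  toFun q := q.1.2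
  map_smul' _ _ := rfl

theorem isPullbackSquare_fibreProd (f : X →[G] Z) (g : Y →[G] Z) :
    IsPullbackSquare (fibreFst f g) (fibreSnd f g) f g :=
  ⟨fun q => q.2, fun x y h => ⟨⟨(x, y), h⟩, ⟨rfl, rfl⟩, fun _ hq =>
    Subtype.ext (Prod.ext hq.1 hq.2)⟩⟩

theorem isPullbackSquare_inl (f : X →[G] Z) (g : Y →[G] W) :
    IsPullbackSquare f (inl X Y) (inl Z W) (sumMap f g) := by
  refine ⟨fun a => rfl, ?_⟩
  rintro z (x | y) h
  · exact ⟨x, ⟨(Sum.inl_injective h).symm, rfl⟩, fun a ha => Sum.inl_injective ha.2⟩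
  · cases h

theorem isPullbackSquare_inr (f : X →[G] Z) (g : Y →[G] W) :
    IsPullbackSquare g (inr X Y) (inr Z W) (sumMap f g) := by
  refine ⟨fun a => rfl, ?_⟩
  rintro z (x | y) h
  · cases h
  · exact ⟨y, ⟨(Sum.inr_injective h).symm, rfl⟩, fun a ha => Sum.inr_injective ha.2⟩

theorem isPullbackSquare_fold (f : X →[G] Y) :
    IsPullbackSquare X.fold (sumMap f f) f Y.fold := by
  refine ⟨by rintro (a | a) <;> rfl, ?_⟩
  rintro x (y | y) h
  · refine ⟨Sum.inl x, ⟨rfl, congrArg Sum.inl h⟩, ?_⟩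
    rintro (a | a) ⟨h1, h2⟩
    · exact congrArg Sum.inl h1
    · cases h2
  · refine ⟨Sum.inr x, ⟨rfl, congrArg Sum.inr h⟩, ?_⟩
    rintro (a | a) ⟨h1, h2⟩
    · cases h2
    · exact congrArg Sum.inr h1

/-- Over `z`, the left value of a section is forced and the right value is a point of `u⁻¹(z)`, so
the dependent product is `X`. This is the source of Frobenius reciprocity. -/
theorem isExponential_fold (u : X →[G] Y) :
    IsExponential (sumMap (MulActionHom.id G) u) Y.fold (sumMap u (MulActionHom.id G)) X.fold
      u := by
  refine ⟨⟨by rintro (a | a) <;> rfl, ?_⟩, ?_⟩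
  · rintro (y | y) x h
    · refine ⟨Sum.inl x, ⟨congrArg Sum.inl h.symm, rfl⟩, ?_⟩
      rintro (a | a) ⟨h1, h2⟩
      · exact congrArg Sum.inl h2
      · cases h1
    · refine ⟨Sum.inr x, ⟨congrArg Sum.inr h.symm, rfl⟩, ?_⟩
      rintro (a | a) ⟨h1, h2⟩
      · cases h1
      · exact congrArg Sum.inr h2
  · intro z s hs
    have h1 := hs ⟨Sum.inl z, rfl⟩
    have h2 := hs ⟨Sum.inr z, rfl⟩
    obtain ⟨x, hx⟩ : ∃ x, s ⟨Sum.inr z, rfl⟩ = Sum.inr x := by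
      rcases h : s ⟨Sum.inr z, rfl⟩ with x | x
      · rw [h] at h2; cases h2
      · exact ⟨x, rfl⟩
    have hl : s ⟨Sum.inl z, rfl⟩ = Sum.inl z := by
      rcases h : s ⟨Sum.inl z, rfl⟩ with x | x
      · rw [h] at h1; exact congrArg Sum.inl (Sum.inl_injective h1)
      · rw [h] at h1; cases h1
    have hxz : u x = z := by rw [hx] at h2; exact Sum.inr_injective h2
    refine ⟨x, ⟨hxz, ?_⟩, ?_⟩
    · rintro (a | a) ⟨(y | y), hy⟩ h h'
      · subst hy
        exact (congrArg Sum.inl (Sum.inl_injective h')).trans hl.symm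
      · cases h'
      · cases h'
      · subst hy
        exact (congrArg Sum.inr h).trans hx.symm
    · rintro b ⟨hb, hb'⟩
      have := hb' (Sum.inr b) ⟨Sum.inr z, rfl⟩ rfl (congrArg Sum.inr hb)
      rw [hx] at this
      exact Sum.inr_injective this

/-- A nonempty fibre has no section into the empty set; an empty fibre would have exactly one,
whence the surjectivity of `f`. -/
theorem isExponential_of_isEmpty {A B : FinGSet G} [IsEmpty X] [IsEmpty A] [IsEmpty B]
    (g : X →[G] Y) (f : Y →[G] Z) (hf : Function.Surjective f) (ε : A →[G] X) (f' : A →[G] B)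
    (p : B →[G] Z) : IsExponential g f ε f' p := by
  refine ⟨⟨fun a => isEmptyElim a, fun y b => isEmptyElim b⟩, fun z s => ?_⟩
  obtain ⟨y, hy⟩ := hf z
  exact isEmptyElim (s ⟨y, hy⟩)

-- A section over `f⁻¹(z)` is encoded by its image, a subset of `X`: finiteness and the `G`-action
-- then come from `Set X`. `A` is the incidence relation.
open scoped Pointwise in
theorem exists_isExponential (g : X →[G] Y) (f : Y →[G] Z) :
    ∃ (A B : FinGSet G) (ε : A →[G] X) (f' : A →[G] B) (p : B →[G] Z),
      IsExponential g f ε f' p := by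
  let S : FinGSet G := { carrier := Set X }
  let B : FinGSet G := subset (X := Z.prod S)
    (fun b => (∀ x ∈ (b.2 : Set X), f (g x) = b.1) ∧
      ∀ y, f y = b.1 → ∃! x, x ∈ (b.2 : Set X) ∧ g x = y) (by
      rintro a ⟨z, s⟩ ⟨h0, h⟩
      refine ⟨fun x hx => ?_, fun y hy => ?_⟩
      · have := h0 _ (Set.mem_smul_set_iff_inv_smul_mem.1 hx)
        rw [map_smul, map_smul, inv_smul_eq_iff] at this
        exact this
      obtain ⟨x, ⟨hx, hxy⟩, hu⟩ := h (a⁻¹ • y) (by rw [map_smul, hy]; exact inv_smul_smul a z)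
      refine ⟨a • x, ⟨Set.smul_mem_smul_set hx, by rw [map_smul, hxy, smul_inv_smul]⟩, ?_⟩
      rintro x' ⟨hx', hy'⟩
      rw [← hu (a⁻¹ • x') ⟨Set.mem_smul_set_iff_inv_smul_mem.1 hx', by rw [map_smul, hy']⟩,
        smul_inv_smul])
  let p : B →[G] Z := { toFun := fun b => b.1.1, map_smul' := fun _ _ => rfl }
  let A : FinGSet G := subset (X := X.prod B) (fun q => q.1 ∈ (q.2.1.2 : Set X))
    fun _ _ h => Set.smul_mem_smul_set h
  refine ⟨A, B, { toFun := fun q => q.1.1, map_smul' := fun _ _ => rfl },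
    { toFun := fun q => q.1.2, map_smul' := fun _ _ => rfl }, p,
    ⟨fun q => q.1.2.2.1 _ q.2, fun y b h => ?_⟩, fun z s hs => ?_⟩
  · obtain ⟨x, ⟨hx, hxy⟩, hu⟩ := b.2.2 y h
    refine ⟨⟨(x, b), hx⟩, ⟨hxy, rfl⟩, ?_⟩
    rintro ⟨⟨x', b'⟩, hx'⟩ ⟨h1, h2⟩
    cases (show b' = b from h2)
    exact Subtype.ext (Prod.ext (hu x' ⟨hx', h1⟩) rfl)
  · refine ⟨⟨(z, Set.range s), ?_, fun y hy => ⟨s ⟨y, hy⟩, ⟨⟨_, rfl⟩, hs _⟩, ?_⟩⟩, ⟨rfl, ?_⟩, ?_⟩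
    · rintro _ ⟨y, rfl⟩
      exact (congrArg f (hs y)).trans y.2
    · rintro _ ⟨⟨y', rfl⟩, h⟩
      exact congrArg s (Subtype.ext ((hs y').symm.trans h))
    · rintro ⟨⟨x, b⟩, hx⟩ y h hy
      cases (show b = _ from h)
      obtain ⟨y', hy'⟩ := hx
      exact hy'.symm.trans
        (congrArg s (Subtype.ext ((hs y').symm.trans ((congrArg g hy').trans hy))))
    · rintro ⟨⟨z', t⟩, h0, h⟩ ⟨hz, ht⟩
      obtain rfl : z' = z := hz
      refine Subtype.ext (Prod.ext rfl (Set.ext fun x => ⟨fun hx => ?_, ?_⟩))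
      · exact ⟨⟨g x, h0 x hx⟩, (ht ⟨(x, ⟨(z', t), h0, h⟩), hx⟩ ⟨g x, h0 x hx⟩ rfl rfl).symm⟩
      · rintro ⟨y, rfl⟩
        obtain ⟨x, ⟨hx, hxy⟩, -⟩ := h y.1 y.2
        have : x = s y := ht ⟨(x, ⟨(z', t), h0, h⟩), hx⟩ y rfl hxy
        exact this ▸ hx

/-- The map `G/H → X` that sends the base point to a given `H`-fixed point. -/
def ofFixed (H : Subgroup G) [Finite G] (x : X) (hx : H ≤ MulAction.stabilizer G x) :
    orbit H →[G] X where
  toFun := Quotient.lift (fun a : G => a • x) fun a b h => by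
    have := hx (QuotientGroup.leftRel_apply.1 h)
    rw [MulAction.mem_stabilizer_iff, mul_smul, inv_smul_eq_iff] at this
    exact this.symm
  map_smul' a q := by
    induction q using QuotientGroup.induction_on with
    | H b => exact mul_smul a b x

end FinGSet

/-! ### Calculus of transfers, norms and restrictions. -/

namespace TambaraFunctor

open FinGSet

variable {G : Type u} [Group G] {T : TambaraFunctor.{u, v} G} {X Y Z C D E : FinGSet G}

theorem exists_pair (a : T.obj X) (b : T.obj Y) :
    ∃ e : T.obj (X.sum Y), T.res (inl X Y) e = a ∧ T.res (inr X Y) e = b := by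
  obtain ⟨e, he⟩ := (T.bijective_res_sum X Y).2 (a, b)
  exact ⟨e, congrArg Prod.fst he, congrArg Prod.snd he⟩

theorem ext_sum {e e' : T.obj (X.sum Y)} (hl : T.res (inl X Y) e = T.res (inl X Y) e')
    (hr : T.res (inr X Y) e = T.res (inr X Y) e') : e = e' :=
  (T.bijective_res_sum X Y).1 (Prod.ext hl hr)

theorem fold_comp_sumMap (f : X →[G] Z) (g : Y →[G] Z) :
    Z.fold.comp (sumMap f g) = desc f g := by
  ext (x | y) <;> rfl

theorem comp_fold (f : X →[G] Z) : f.comp X.fold = desc f f := by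
  ext (x | y) <;> rfl

theorem tr_desc (f : X →[G] Z) (g : Y →[G] Z) (e : T.obj (X.sum Y)) :
    T.tr (desc f g) e = T.tr f (T.res (inl X Y) e) + T.tr g (T.res (inr X Y) e) := by
  rw [← fold_comp_sumMap, T.tr_comp, T.tr_fold, T.res_tr (isPullbackSquare_inl f g),
    T.res_tr (isPullbackSquare_inr f g)]

theorem nm_desc (f : X →[G] Z) (g : Y →[G] Z) (e : T.obj (X.sum Y)) :
    T.nm (desc f g) e = T.nm f (T.res (inl X Y) e) * T.nm g (T.res (inr X Y) e) := by
  rw [← fold_comp_sumMap, T.nm_comp, T.nm_fold, T.res_nm (isPullbackSquare_inl f g),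
    T.res_nm (isPullbackSquare_inr f g)]

theorem tr_add (f : X →[G] Y) (a b : T.obj X) : T.tr f (a + b) = T.tr f a + T.tr f b := by
  obtain ⟨e, rfl, rfl⟩ := exists_pair a b
  rw [← T.tr_fold, ← T.tr_comp, comp_fold, tr_desc]

theorem nm_mul (f : X →[G] Y) (a b : T.obj X) : T.nm f (a * b) = T.nm f a * T.nm f b := by
  obtain ⟨e, rfl, rfl⟩ := exists_pair a b
  rw [← T.nm_fold, ← T.nm_comp, comp_fold, nm_desc]

theorem res_inl_sumMap (f : X →[G] Y) (g : Z →[G] C) (e : T.obj (Y.sum C)) :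
    T.res (inl X Z) (T.res (sumMap f g) e) = T.res f (T.res (inl Y C) e) := by
  rw [← T.res_comp, ← T.res_comp]; rfl

theorem res_inr_sumMap (f : X →[G] Y) (g : Z →[G] C) (e : T.obj (Y.sum C)) :
    T.res (inr X Z) (T.res (sumMap f g) e) = T.res g (T.res (inr Y C) e) := by
  rw [← T.res_comp, ← T.res_comp]; rfl

theorem res_add (f : X →[G] Y) (a b : T.obj Y) : T.res f (a + b) = T.res f a + T.res f b := by
  obtain ⟨e, rfl, rfl⟩ := exists_pair a b
  rw [← T.tr_fold, T.res_tr (isPullbackSquare_fold f), T.tr_fold, res_inl_sumMap,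
    res_inr_sumMap]

theorem res_mul (f : X →[G] Y) (a b : T.obj Y) : T.res f (a * b) = T.res f a * T.res f b := by
  obtain ⟨e, rfl, rfl⟩ := exists_pair a b
  rw [← T.nm_fold, T.res_nm (isPullbackSquare_fold f), T.nm_fold, res_inl_sumMap,
    res_inr_sumMap]

theorem tr_zero (f : X →[G] Y) : T.tr f 0 = 0 := by
  simpa using tr_add f (0 : T.obj X) 0

theorem res_zero (f : X →[G] Y) : T.res f 0 = 0 := by
  simpa using res_add f (0 : T.obj Y) 0

theorem eq_of_isEmpty [h : IsEmpty X] (a b : T.obj X) : a = b :=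
  have := T.subsingleton_of_isEmpty X h
  Subsingleton.elim a b

/-- Zero is a transfer from the empty set, and distributivity turns its norm into another such
transfer. -/
theorem nm_zero (f : X →[G] Y) (hf : Function.Surjective f) : T.nm f 0 = 0 := by
  have h := T.nm_tr (isExponential_of_isEmpty (ofIsEmpty : empty G →[G] X) f hf
    (MulActionHom.id G : empty G →[G] empty G) (MulActionHom.id G) ofIsEmpty) 0
  rwa [tr_zero, eq_of_isEmpty (X := empty G) (T.nm _ _) 0, tr_zero] at h

/-- Positive exponents avoid the need for `nm f 1 = 1`. -/
theorem nm_pow_succ (f : X →[G] Y) (a : T.obj X) (k : ℕ) :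
    T.nm f (a ^ (k + 1)) = T.nm f a ^ (k + 1) := by
  induction k with
  | zero => simp
  | succ k ih => rw [pow_succ, nm_mul, ih, ← pow_succ]

theorem res_pow_succ (f : X →[G] Y) (a : T.obj Y) (k : ℕ) :
    T.res f (a ^ (k + 1)) = T.res f a ^ (k + 1) := by
  induction k with
  | zero => simp
  | succ k ih => rw [pow_succ, res_mul, ih, ← pow_succ]

/-- Frobenius reciprocity. -/
theorem mul_tr (u : X →[G] Y) (b : T.obj Y) (a : T.obj X) :
    b * T.tr u a = T.tr u (T.res u b * a) := by
  obtain ⟨e, rfl, rfl⟩ := exists_pair b a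
  have h := T.nm_tr (isExponential_fold u) e
  rw [T.nm_fold, T.nm_fold, T.res_tr (isPullbackSquare_inl _ _),
    T.res_tr (isPullbackSquare_inr _ _), res_inl_sumMap, res_inr_sumMap, T.tr_id, T.res_id] at h
  exact h

theorem tr_mul_tr (u : C →[G] Y) (u' : D →[G] Y) (a : T.obj C) (b : T.obj D) :
    T.tr u a * T.tr u' b = T.tr (u.comp (fibreFst u u'))
      (T.res (fibreFst u u') a * T.res (fibreSnd u u') b) := by
  rw [mul_comm, mul_tr, T.res_tr (isPullbackSquare_fibreProd u u'), mul_comm, mul_tr, T.tr_comp]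

theorem nm_res_of_bijective {f : X →[G] Y} (hf : Function.Bijective f) (a : T.obj Y) :
    T.nm f (T.res f a) = a := by
  let g : Y →[G] X := f.inverse (Equiv.ofBijective f hf).symm
    (Equiv.ofBijective f hf).symm_apply_apply (Equiv.ofBijective f hf).apply_symm_apply
  have hfg : ∀ y, f (g y) = y := (Equiv.ofBijective f hf).apply_symm_apply
  have hgf : ∀ x, g (f x) = x := (Equiv.ofBijective f hf).symm_apply_apply
  have h : IsPullbackSquare g (MulActionHom.id G) f (MulActionHom.id G) :=
    ⟨hfg, fun x y h => ⟨y, ⟨(congrArg g h).symm.trans (hgf x), rfl⟩, fun _ ha => ha.2⟩⟩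
  have h2 := T.res_nm h a
  rw [T.nm_id, T.res_id] at h2
  rw [h2, ← T.nm_comp, show f.comp g = MulActionHom.id G from MulActionHom.ext hfg, T.nm_id]

/-- The complement of the image of `j`. -/
def compl (j : E →[G] C) : FinGSet G :=
  subset (fun c : C => ∀ e, j e ≠ c) fun a c h e he =>
    h (a⁻¹ • e) (by rw [map_smul, he, inv_smul_smul])

/-- The inclusion of the complement of the image of `j`. -/
def complVal (j : E →[G] C) : compl j →[G] C := subsetVal _ _

theorem bijective_desc_complVal {j : E →[G] C} (hj : Function.Injective j) :
    Function.Bijective (desc j (complVal j)) := by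
  constructor
  · rintro (e | c) (e' | c') h
    · exact congrArg Sum.inl (hj h)
    · exact (c'.2 e h).elim
    · exact (c.2 e' h.symm).elim
    · exact congrArg Sum.inr (Subtype.ext h)
  · intro c
    by_cases h : ∃ e, j e = c
    · exact ⟨Sum.inl h.choose, h.choose_spec⟩
    · exact ⟨Sum.inr ⟨c, not_exists.1 h⟩, rfl⟩

theorem nm_eq_mul_of_injective {j : E →[G] C} (hj : Function.Injective j) (v : C →[G] D)
    (y : T.obj C) : T.nm v y =
      T.nm (v.comp j) (T.res j y) * T.nm (v.comp (complVal j)) (T.res (complVal j) y) := by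
  have h1 : v.comp (desc j (complVal j)) = desc (v.comp j) (v.comp (complVal j)) := by
    ext (x | y) <;> rfl
  conv_lhs => rw [← nm_res_of_bijective (bijective_desc_complVal hj) y]
  rw [← T.nm_comp, h1, nm_desc, ← T.res_comp, ← T.res_comp]
  rfl

theorem eq_zero_of_res_injective {j : E →[G] C} (hj : Function.Injective j) {y : T.obj C}
    (h1 : T.res j y = 0) (h2 : T.res (complVal j) y = 0) : y = 0 := by
  have h : T.res (desc j (complVal j)) y = 0 := by
    refine ext_sum ?_ ?_ <;> rw [← T.res_comp, res_zero]
    · exact h1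
    · exact h2
  rw [← nm_res_of_bijective (bijective_desc_complVal hj) y, h,
    nm_zero _ (bijective_desc_complVal hj).2]

theorem ofFixed_injective [Finite G] (x : X) :
    Function.Injective (ofFixed (MulAction.stabilizer G x) x le_rfl) := by
  rintro ⟨a⟩ ⟨b⟩ h
  have h : a • x = b • x := h
  refine Quotient.sound (QuotientGroup.leftRel_apply.2 ?_)
  rw [MulAction.mem_stabilizer_iff, mul_smul, ← h, inv_smul_smul]

/-- Induction on the cardinality: split off the orbit of a point and pass to its complement. -/
theorem eq_zero_of_res_orbit [Finite G] (a : T.obj X)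
    (h : ∀ (H : Subgroup G) (f : orbit H →[G] X), T.res f a = 0) : a = 0 := by
  induction hn : Nat.card X using Nat.strong_induction_on generalizing X with
  | _ n ih =>
    subst hn
    rcases isEmpty_or_nonempty X with hX | ⟨⟨x⟩⟩
    · exact eq_of_isEmpty _ _
    refine eq_zero_of_res_injective (ofFixed_injective x) (h _ _)
      (ih _ ?_ _ (fun H f => by rw [← T.res_comp]; exact h _ _) rfl)
    refine Finite.card_subtype_lt (x := x) fun hx => hx (QuotientGroup.mk 1) ?_
    exact one_smul G x

end TambaraFunctor

/-! ### Norm products, their weights and their transfers. -/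

namespace TambaraFunctor

open FinGSet

variable {G : Type u} [Group G] {T : TambaraFunctor.{u, v} G} {X Y Z C D E : FinGSet G}

/-- Every fibre of `v` has at least `m` points. -/
def HasFibres (m : ℕ) (v : C →[G] D) : Prop :=
  ∀ d, ∃ i : Fin m → C, Function.Injective i ∧ ∀ j, v (i j) = d

theorem HasFibres.of_isPullbackSquare {m : ℕ} {g' : X →[G] Y} {f' : X →[G] C} {f : Y →[G] D}
    {v : C →[G] D} (h : IsPullbackSquare g' f' f v) (hv : HasFibres m v) : HasFibres m g' := by
  intro y
  obtain ⟨i, hi, hvi⟩ := hv (f y)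
  choose k hk _ using fun j => h.2 y (i j) (hvi j).symm
  exact ⟨k, fun a b hab => hi ((hk a).2.symm.trans ((congrArg f' hab).trans (hk b).2)),
    fun j => (hk j).1⟩

/-- Each fibre of the composite contains a whole fibre of `v`; it may be larger, so only lower
bounds on fibres are stable. -/
theorem HasFibres.comp {m : ℕ} {v : C →[G] D} (hv : HasFibres m v) {f : D →[G] E}
    (hf : Function.Surjective f) : HasFibres m (f.comp v) := by
  intro e
  obtain ⟨d, rfl⟩ := hf e
  obtain ⟨i, hi, hvi⟩ := hv d
  exact ⟨i, hi, fun j => congrArg f (hvi j)⟩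

theorem HasFibres.desc {m n : ℕ} {v : C →[G] E} {w : D →[G] E} (hv : HasFibres m v)
    (hw : HasFibres n w) : HasFibres (m + n) (desc v w) := by
  intro e
  obtain ⟨i, hi, hvi⟩ := hv e
  obtain ⟨k, hk, hwk⟩ := hw e
  refine ⟨fun j => Sum.map i k (finSumFinEquiv.symm j),
    (hi.sumMap hk).comp finSumFinEquiv.symm.injective, fun j => ?_⟩
  obtain ⟨j, rfl⟩ := finSumFinEquiv.surjective j
  refine (congrArg (fun q : Fin m ⊕ Fin n => FinGSet.desc v w (Sum.map i k q))
    (finSumFinEquiv.symm_apply_apply j)).trans ?_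
  rcases j with j | j
  · exact hvi j
  · exact hwk j

/-- `p` is a norm `nm v (res w x)` along a map `v` whose fibres have at least `m` points. -/
def IsNormProduct (x : T.obj X) (m : ℕ) (p : T.obj D) : Prop :=
  ∃ (C : FinGSet G) (v : C →[G] D) (w : C →[G] X), HasFibres m v ∧ p = T.nm v (T.res w x)

variable {x : T.obj X} {m n : ℕ}

theorem IsNormProduct.res {p : T.obj D} (hp : IsNormProduct x m p) (f : E →[G] D) :
    IsNormProduct x m (T.res f p) := by
  obtain ⟨C, v, w, hv, rfl⟩ := hp
  have h := isPullbackSquare_fibreProd f v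
  exact ⟨_, _, w.comp (fibreSnd f v), hv.of_isPullbackSquare h, by
    rw [T.res_nm h, T.res_comp]⟩

theorem IsNormProduct.nm {p : T.obj D} (hp : IsNormProduct x m p) {f : D →[G] E}
    (hf : Function.Surjective f) : IsNormProduct x m (T.nm f p) := by
  obtain ⟨C, v, w, hv, rfl⟩ := hp
  exact ⟨C, f.comp v, w, hv.comp hf, (T.nm_comp _ _ _).symm⟩

theorem IsNormProduct.mul {p q : T.obj D} (hp : IsNormProduct x m p)
    (hq : IsNormProduct x n q) : IsNormProduct x (m + n) (p * q) := by
  obtain ⟨C, v, w, hv, rfl⟩ := hp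
  obtain ⟨C', v', w', hv', rfl⟩ := hq
  refine ⟨_, _, desc w w', hv.desc hv', ?_⟩
  rw [nm_desc, ← T.res_comp, ← T.res_comp]
  rfl

/-- `a` is a transfer of a multiple of a norm product of weight at least `m`. -/
def IsTransfer (x : T.obj X) (m : ℕ) (a : T.obj Y) : Prop :=
  ∃ (D : FinGSet G) (u : D →[G] Y) (c p : T.obj D), IsNormProduct x m p ∧ a = T.tr u (c * p)

theorem isTransfer_zero : IsTransfer x m (0 : T.obj Y) :=
  ⟨empty G, ofIsEmpty, 0, T.nm (MulActionHom.id G) (T.res ofIsEmpty x),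
    -- Over the empty base every weight condition is vacuous.
    ⟨empty G, MulActionHom.id G, ofIsEmpty, fun d => isEmptyElim d, rfl⟩, by
      rw [zero_mul, tr_zero]⟩

/-- The bases `D` and `D'` are put side by side, so each fibre is an old one and the weight stays
`m`. -/
theorem IsTransfer.add {a b : T.obj Y} (ha : IsTransfer x m a) (hb : IsTransfer x m b) :
    IsTransfer x m (a + b) := by
  obtain ⟨D, u, c, p, ⟨C, v, w, hv, rfl⟩, rfl⟩ := ha
  obtain ⟨D', u', c', p', ⟨C', v', w', hv', rfl⟩, rfl⟩ := hb
  obtain ⟨e, rfl, rfl⟩ := exists_pair c c'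
  refine ⟨_, FinGSet.desc u u', e, T.nm (sumMap v v') (T.res (FinGSet.desc w w') x),
    ⟨_, sumMap v v', FinGSet.desc w w', ?_, rfl⟩, ?_⟩
  · rintro (d | d)
    · obtain ⟨i, hi, hvi⟩ := hv d
      exact ⟨fun j => Sum.inl (i j), Sum.inl_injective.comp hi,
        fun j => congrArg Sum.inl (hvi j)⟩
    · obtain ⟨i, hi, hvi⟩ := hv' d
      exact ⟨fun j => Sum.inr (i j), Sum.inr_injective.comp hi,
        fun j => congrArg Sum.inr (hvi j)⟩
  · rw [tr_desc, res_mul, res_mul, T.res_nm (isPullbackSquare_inl v v'),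
      T.res_nm (isPullbackSquare_inr v v'), ← T.res_comp, ← T.res_comp]
    rfl

/-- Over the fibre product of the bases both norm products live on one `G`-set, where the fibres are
joined and weights add. -/
theorem IsTransfer.mul {a b : T.obj Y} (ha : IsTransfer x m a) (hb : IsTransfer x n b) :
    IsTransfer x (m + n) (a * b) := by
  obtain ⟨D, u, c, p, hp, rfl⟩ := ha
  obtain ⟨D', u', c', p', hp', rfl⟩ := hb
  refine ⟨_, u.comp (fibreFst u u'), T.res (fibreFst u u') c * T.res (fibreSnd u u') c', _,
    (hp.res (fibreFst u u')).mul (hp'.res (fibreSnd u u')), ?_⟩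
  rw [tr_mul_tr, res_mul, res_mul, mul_mul_mul_comm]

theorem IsTransfer.mul_left {a : T.obj Y} (b : T.obj Y) (ha : IsTransfer x m a) :
    IsTransfer x m (b * a) := by
  obtain ⟨D, u, c, p, hp, rfl⟩ := ha
  exact ⟨D, u, T.res u b * c, p, hp, by rw [mul_tr, mul_assoc]⟩

theorem IsTransfer.res {a : T.obj Y} (ha : IsTransfer x m a) (f : Z →[G] Y) :
    IsTransfer x m (T.res f a) := by
  obtain ⟨D, u, c, p, hp, rfl⟩ := ha
  exact ⟨_, fibreFst f u, _, _, hp.res (fibreSnd f u), by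
    rw [T.res_tr (isPullbackSquare_fibreProd f u), res_mul]⟩

theorem IsTransfer.tr {a : T.obj Y} (ha : IsTransfer x m a) (f : Y →[G] Z) :
    IsTransfer x m (T.tr f a) := by
  obtain ⟨D, u, c, p, hp, rfl⟩ := ha
  exact ⟨D, f.comp u, c, p, hp, (T.tr_comp _ _ _).symm⟩

/-- Distributivity rewrites the norm of a transfer as a transfer of a norm along `f'`, which is
surjective as a pullback of `f`; the weight therefore does not drop. -/
theorem IsTransfer.nm {a : T.obj Y} (ha : IsTransfer x m a) {f : Y →[G] Z}
    (hf : Function.Surjective f) : IsTransfer x m (T.nm f a) := by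
  obtain ⟨D, u, c, p, hp, rfl⟩ := ha
  obtain ⟨A, B, ε, f', q, h⟩ := exists_isExponential u f
  have hf' : Function.Surjective f' := fun b => by
    obtain ⟨y, hy⟩ := hf (q b)
    obtain ⟨a, ha, -⟩ := h.1.2 y b hy
    exact ⟨a, ha.2⟩
  exact ⟨B, q, T.nm f' (T.res ε c), _, (hp.res ε).nm hf', by
    rw [T.nm_tr h, res_mul, nm_mul]⟩

theorem isTransfer_res (x : T.obj X) (f : Y →[G] X) : IsTransfer x 1 (T.res f x) :=
  ⟨Y, MulActionHom.id G, 1, T.res f x,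
    ⟨Y, MulActionHom.id G, f, fun d => ⟨fun _ => d, fun _ _ _ => Subsingleton.elim _ _,
      fun _ => rfl⟩, (T.nm_id _).symm⟩, by rw [one_mul, T.tr_id]⟩

theorem exists_nilpotent_of_fin {n : ℕ} (Y : Fin n → FinGSet G) (y : ∀ i, T.obj (Y i))
    (hy : ∀ i, IsNilpotent (y i)) :
    ∃ (X : FinGSet G) (x : T.obj X), IsNilpotent x ∧
      ∀ i, ∃ f : Y i →[G] X, T.res f x = y i := by
  induction n with
  | zero => exact ⟨empty G, 0, IsNilpotent.zero, fun i => i.elim0⟩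
  | succ n ih =>
    obtain ⟨X, x, ⟨k, hk⟩, h⟩ := ih (fun i => Y i.succ) (fun i => y i.succ) fun i => hy i.succ
    obtain ⟨l, hl⟩ := hy 0
    obtain ⟨e, rfl, he⟩ := exists_pair x (y 0)
    -- The exponent kills both components; the extra one makes `res_pow_succ` applicable.
    refine ⟨_, e, ⟨k + l + 1, ext_sum ?_ ?_⟩, Fin.cases ⟨_, he⟩ fun i => ?_⟩
    · rw [res_pow_succ, res_zero]
      exact pow_eq_zero_of_le (by omega) hk
    · rw [res_pow_succ, res_zero, he]
      exact pow_eq_zero_of_le (by omega) hl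
    · obtain ⟨f, hf⟩ := h i
      exact ⟨(inl _ _).comp f, by rw [T.res_comp, hf]⟩

/-! ### The ideal of transfers, and vanishing in large weight. -/

variable [Finite G]

/-- The Tambara ideal of transfers of multiples of norm products of weight at least `m`. -/
def transferIdeal (x : T.obj X) (m : ℕ) : TambaraIdeal T where
  level H :=
    { carrier := {a | IsTransfer x m a}
      add_mem' := IsTransfer.add
      zero_mem' := isTransfer_zero
      smul_mem' := fun b _ ha => IsTransfer.mul_left b ha }
  res_mem h _ ha := ha.res (proj h)
  tr_mem h _ ha := ha.tr (proj h)
  nm_mem h _ ha := ha.nm (f := proj h) fun q => by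
    induction q using QuotientGroup.induction_on with
    | H g => exact ⟨QuotientGroup.mk g, rfl⟩
  conj_mem g H _ ha := ha.tr (conjMap g H)

theorem orbit_hom_ext {L : Subgroup G} {f g : orbit L →[G] X}
    (h : f (QuotientGroup.mk 1 : G ⧸ L) = g (QuotientGroup.mk 1 : G ⧸ L)) : f = g := by
  refine MulActionHom.ext fun q => ?_
  induction q using QuotientGroup.induction_on with
  | H a =>
    have ha : (QuotientGroup.mk a : G ⧸ L) = a • (QuotientGroup.mk 1 : G ⧸ L) :=
      congrArg QuotientGroup.mk (mul_one a).symm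
    have hf := map_smul f a (QuotientGroup.mk 1 : G ⧸ L)
    have hg := map_smul g a (QuotientGroup.mk 1 : G ⧸ L)
    rw [ha]
    exact hf.trans ((congrArg (a • ·) h).trans hg.symm)

theorem surjective_of_orbit {L : Subgroup G} [Nonempty C] (f : C →[G] orbit L) :
    Function.Surjective f := by
  intro q
  obtain ⟨c⟩ := ‹Nonempty C›
  obtain ⟨a, ha⟩ := MulAction.exists_smul_eq (M := G) (α := G ⧸ L) (f c) q
  exact ⟨a • c, (map_smul f a c).trans ha⟩

theorem exists_orbit_embedding {L : Subgroup G} {c : C} (hc : MulAction.stabilizer G c = L) :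
    ∃ j : orbit L →[G] C, Function.Injective j ∧ j (QuotientGroup.mk 1 : G ⧸ L) = c ∧
      ∀ e, ∃ a : G, a • c = j e := by
  subst hc
  refine ⟨ofFixed _ c le_rfl, ofFixed_injective c, one_smul G c, fun e => ?_⟩
  induction e using QuotientGroup.induction_on with
  | H a => exact ⟨a, rfl⟩

/-- The orbit of any `c ∈ S` is a copy of `G/L` on which `v` and `w` become `v₀` and `w₀`, so it
splits off one factor. It uses up at most `|G|` points of `S`, which leaves enough for the next
step. -/
theorem pow_dvd_nm {L : Subgroup G} (v₀ : orbit L →[G] D) (w₀ : orbit L →[G] X) (x : T.obj X)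
    (k : ℕ) (v : C →[G] D) (w : C →[G] X) (S : Finset C)
    (hS : ∀ c ∈ S, MulAction.stabilizer G c = L ∧ v c = v₀ (QuotientGroup.mk 1 : G ⧸ L) ∧
      w c = w₀ (QuotientGroup.mk 1 : G ⧸ L)) (hk : Nat.card G * k < S.card) :
    T.nm v₀ (T.res w₀ x) ^ (k + 1) ∣ T.nm v (T.res w x) := by
  classical
  induction k generalizing C with
  | zero =>
    obtain ⟨c, hc⟩ := Finset.card_pos.1 ((Nat.zero_le _).trans_lt hk)
    obtain ⟨hL, hv, hw⟩ := hS c hc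
    obtain ⟨j, hj, hjc, -⟩ := exists_orbit_embedding hL
    have hvj : v.comp j = v₀ := orbit_hom_ext ((congrArg v hjc).trans hv)
    have hwj : w.comp j = w₀ := orbit_hom_ext ((congrArg w hjc).trans hw)
    rw [nm_eq_mul_of_injective hj, ← T.res_comp, hvj, hwj, zero_add, pow_one]
    exact dvd_mul_right _ _
  | succ k ih =>
    obtain ⟨c, hc⟩ := Finset.card_pos.1 ((Nat.zero_le _).trans_lt hk)
    obtain ⟨hL, hv, hw⟩ := hS c hc
    obtain ⟨j, hj, hjc, hjo⟩ := exists_orbit_embedding hL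
    have hvj : v.comp j = v₀ := orbit_hom_ext ((congrArg v hjc).trans hv)
    have hwj : w.comp j = w₀ := orbit_hom_ext ((congrArg w hjc).trans hw)
    rw [nm_eq_mul_of_injective hj, ← T.res_comp, ← T.res_comp, hvj, hwj, pow_succ' _ (k + 1)]
    -- The induction continues on the complement of the orbit, with the points of `S` outside it.
    refine mul_dvd_mul_left _ (ih _ _ (S.subtype fun c' => ∀ e, j e ≠ c') ?_ ?_)
    · intro c' hc'
      obtain ⟨h1, h2, h3⟩ := hS _ (Finset.mem_subtype.1 hc')
      refine ⟨Eq.trans ?_ h1, h2, h3⟩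
      ext a
      exact Subtype.ext_iff
    · have : Fintype G := Fintype.ofFinite G
      have h1 : (S.filter fun c' => ¬ ∀ e, j e ≠ c').card ≤ Nat.card G := by
        rw [Nat.card_eq_fintype_card, ← Finset.card_univ]
        refine (Finset.card_le_card fun c' hc' => ?_).trans
          (Finset.card_image_le (f := fun a : G => a • c))
        obtain ⟨e, he⟩ := not_forall_not.1 (Finset.mem_filter.1 hc').2
        obtain ⟨a, ha⟩ := hjo e
        exact Finset.mem_image.2 ⟨a, Finset.mem_univ _, ha.trans he⟩
      have h2 := S.card_filter_add_card_filter_not fun c' => ∀ e, j e ≠ c'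
      refine lt_of_lt_of_eq ?_ (Finset.card_subtype (fun c' => ∀ e, j e ≠ c') S).symm
      rw [mul_add, mul_one] at hk
      omega

/-- The bound depends only on `G`, `X` and the nilpotency exponent, hence is uniform in `D`. -/
theorem exists_nm_eq_zero {x : T.obj X} (hx : IsNilpotent x) :
    ∃ M : ℕ, ∀ {D : FinGSet G} (p : T.obj D), IsNormProduct x (M + 1) p → p = 0 := by
  classical
  obtain ⟨k, hk⟩ := hx
  have hk : x ^ (k + 1) = 0 := pow_eq_zero_of_le k.le_succ hk
  have : Fintype (Subgroup G × X) := Fintype.ofFinite _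
  refine ⟨Fintype.card (Subgroup G × X) * (Nat.card G * k), fun p hp =>
    eq_zero_of_res_orbit p fun H f => ?_⟩
  obtain ⟨C, v, w, hv, h⟩ := hp.res f
  rw [h]
  clear h
  obtain ⟨i, hi, hvi⟩ := hv (QuotientGroup.mk 1 : G ⧸ H)
  -- Pigeonhole: more than `|G| * k` points of the fibre share both stabilizer and image in `X`.
  obtain ⟨⟨L, y⟩, hy⟩ := Fintype.exists_lt_card_fiber_of_mul_lt_card
    (fun j => ((MulAction.stabilizer G (i j), w (i j)) : Subgroup G × X))
    (by rw [Fintype.card_fin]; exact Nat.lt_succ_self _)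
  obtain ⟨j₀, hj₀⟩ := Finset.card_pos.1 ((Nat.zero_le _).trans_lt hy)
  have hfib : ∀ j ∈ Finset.univ.filter fun j =>
      ((MulAction.stabilizer G (i j), w (i j)) : Subgroup G × X) = (L, y),
      MulAction.stabilizer G (i j) = L ∧ w (i j) = y :=
    fun j hj => Prod.ext_iff.1 ((Finset.mem_filter_univ j).1 hj)
  obtain ⟨q, -, hq, -⟩ := exists_orbit_embedding (hfib j₀ hj₀).1
  -- The orbit of the point `i j₀` serves as the model for all the others.
  have hdvd := pow_dvd_nm (v.comp q) (w.comp q) x k v w (Finset.image i _) (by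
    intro c hc
    obtain ⟨j, hj, rfl⟩ := Finset.mem_image.1 hc
    exact ⟨(hfib j hj).1, (hvi j).trans ((congrArg v hq).trans (hvi j₀)).symm,
      (hfib j hj).2.trans ((congrArg w hq).trans (hfib j₀ hj₀).2).symm⟩)
    (by rwa [Finset.card_image_of_injective _ hi])
  have : Nonempty (orbit L) := ⟨(QuotientGroup.mk 1 : G ⧸ L)⟩
  -- The divisor is the norm of the restriction of `x ^ (k + 1) = 0`; the norm is along a map onto
  -- the transitive `G/H`, hence zero.
  rw [← nm_pow_succ, ← res_pow_succ, hk, res_zero, nm_zero _ (surjective_of_orbit _)] at hdvd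
  exact zero_dvd_iff.1 hdvd

theorem TambaraIdeal.span_level_le {ι : Type*} {H : ι → Subgroup G} {x : ∀ i, T.level (H i)}
    {I : TambaraIdeal T} (h : ∀ i, x i ∈ I.level (H i)) (K : Subgroup G) :
    (TambaraIdeal.span H x).level K ≤ I.level K :=
  iInf₂_le I h

theorem TambaraIdeal.mul_level_le {I J K : TambaraIdeal T}
    (h : ∀ H, I.level H * J.level H ≤ K.level H) (H : Subgroup G) :
    (I * J).level H ≤ K.level H :=
  iInf₂_le K h

theorem TambaraIdeal.pow_succ_level_le {I : TambaraIdeal T} {x : T.obj X}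
    (hI : ∀ H, I.level H ≤ (transferIdeal x 1).level H) (k : ℕ) (H : Subgroup G) :
    (I ^ (k + 1)).level H ≤ (transferIdeal x (k + 1)).level H := by
  induction k generalizing H with
  -- The first power is `top * I` by definition.
  | zero => exact mul_level_le (I := top) (fun K => Ideal.mul_le_right.trans (hI K)) H
  | succ k ih =>
    refine mul_level_le (I := I ^ (k + 1)) (fun K => Ideal.mul_le.2 fun a ha b hb => ?_) H
    exact IsTransfer.mul (ih K ha) (hI K hb)

end TambaraFunctor

open TambaraFunctor in
/-- A Tambara ideal generated by finitely many nilpotent elements is nilpotent. -/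
theorem mainTheorem8 {G : Type u} [Group G] [Finite G] (T : TambaraFunctor.{u, v} G) {n : ℕ}
    (H : Fin n → Subgroup G) (x : ∀ i, T.level (H i)) (hx : ∀ i, IsNilpotent (x i)) :
    ∃ N : ℕ, 0 < N ∧ ∀ K : Subgroup G,
      (TambaraFunctor.TambaraIdeal.span H x ^ N).level K = ⊥ := by
  obtain ⟨X, y, hy, h⟩ := exists_nilpotent_of_fin (fun i => FinGSet.orbit (H i)) x hx
  obtain ⟨M, hM⟩ := exists_nm_eq_zero hy
  refine ⟨M + 1, M.succ_pos, fun K => eq_bot_iff.2 fun a ha => ?_⟩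
  have hspan : ∀ L, (TambaraIdeal.span H x).level L ≤ (transferIdeal y 1).level L :=
    TambaraIdeal.span_level_le fun i => by
      obtain ⟨f, hf⟩ := h i
      rw [← hf]
      exact isTransfer_res y f
  obtain ⟨D, u, c, p, hp, rfl⟩ := TambaraIdeal.pow_succ_level_le hspan M K ha
  rw [hM p hp, mul_zero, tr_zero]
  exact Submodule.zero_mem _
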